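/- Let $P=(V,\le)$ be a finite (partially) ordered set that is not totally ordered, and suppose that its cover graph (the graph on $V$ in which $x$ and $y$ are adjacent if and only if one of them covers the other) is a forest, i.e. has no cycle. For $u\in V$ put $D(u)=\{v\in V: v<u\}$ and $U(u)=\{v\in V: u<v\}$. Then: (1) $P$ has a very good pair, that is, there are distinct elements $a,b\in V$ such that, in $P$ or in its dual, the following two conditions hold simultaneously: $D(a)=D(b)$, and both $U(a)\setminus U(b)$ and $U(b)\setminus U(a)$ are (possibly empty) chains. (2) Hence $P$ has a balanced pair, that is, there are $x,y\in V$ such that the proportion $\mathbb{P}(x\prec y)$ of linear extensions of $P$ (total orders on $V$ containing $\le$) that put $x$ strictly before $y$ satisfies $\frac13\le\mathbb{P}(x\prec y)\le\frac23$. In other words, the 1/3–2/3 Conjecture holds for finite ordered sets whose cover graph is a forest. -/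

import Mathlib

namespace OrderedSet

/-- `r` is a linear extension of the ordered set `V`: a (reflexive) total order on `V` that
contains the given order. -/
structure IsLinearExtension {V : Type*} [PartialOrder V] (r : V → V → Prop) : Prop where
  refl : ∀ x, r x x
  trans : ∀ x y z, r x y → r y z → r x z
  antisymm : ∀ x y, r x y → r y x → x = y
  total : ∀ x y, r x y ∨ r y x
  extends_le : ∀ x y, x ≤ y → r x y

/-- The set of all linear extensions of `V`. -/
def linearExtensions (V : Type*) [PartialOrder V] : Set (V → V → Prop) :=
  {r | IsLinearExtension r}

/-- The proportion of the linear extensions of `V` that put `x` (strictly) before `y`. For finite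
`V` both sets are finite, and the denominator is positive because a linear extension exists. -/
noncomputable def probBefore {V : Type*} [PartialOrder V] (x y : V) : ℚ :=
  ({r ∈ linearExtensions V | r x y ∧ x ≠ y}.ncard : ℚ) / ((linearExtensions V).ncard : ℚ)

/-- `(x, y)` is a balanced pair. -/
def IsBalancedPair {V : Type*} [PartialOrder V] (x y : V) : Prop :=
  1 / 3 ≤ probBefore x y ∧ probBefore x y ≤ 2 / 3

/-- The strict down-sets of `a` and `b` agree, and both differences of their strict up-sets are
(possibly empty) chains. -/
def IsUpwardVeryGood {V : Type*} [PartialOrder V] (a b : V) : Prop :=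
  Set.Iio a = Set.Iio b ∧
    IsChain (· ≤ ·) (Set.Ioi a \ Set.Ioi b) ∧ IsChain (· ≤ ·) (Set.Ioi b \ Set.Ioi a)

/-- `(a, b)` is a very good pair of distinct elements: the two conditions hold simultaneously in
the ordered set, or simultaneously in its dual. -/
def IsVeryGoodPair {V : Type*} [PartialOrder V] (a b : V) : Prop :=
  a ≠ b ∧ (IsUpwardVeryGood a b ∨ IsUpwardVeryGood (OrderDual.toDual a) (OrderDual.toDual b))

end OrderedSet

/-!
In a finite ordered set whose cover graph is a forest, every interval is a chain, and deleting an
edge `rv` of the cover graph splits off a side `side r v` that comparabilities can leave only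
through that edge (`covBy_of_le_of_notMem_side`, `covBy_of_le_of_mem_side`).

*Existence of a very good pair.* Suppose that there is none. An edge carries a *tail* if what lies
beyond it is a chain pointing away from it; a *low end* is a minimal element whose up-set is a
chain, a *high end* is the dual notion. Two low ends would be a very good pair, and so would two
tails attached to the same element and pointing in the same direction; so there is at most one
low end and at most one high end, and each element has at most one upward and one downward tail.
On the other hand, every edge either carries a tail or has an end beyond it
(`isTail_or_exists_isEnd`). Hence the cover graph is a path between two ends with tails attached
to it, and up to duality one of the ends is a low end `α`. Following the chain upwards from `α`, a
unique further lower cover `p` is met, attached to some `q` (`IsLowEnd.exists_isLowBranch`), and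
a look at what lies just beyond `p` gives a very good pair after all, both if `q` is the only upper
cover of `p` (`IsLowBranch.false_of_forall_covBy`) and if it is not
(`IsLowBranch.false_of_covBy`).

*From very good to balanced.* Let `a` and `b` have the same strict down-set, let
`b = b₁ < b₂ < ⋯ < bₙ` be `b` and the chain of elements above `b` but not above `a`, and let `a`
precede `b` in at most half of the linear extensions. Exchanging `a` and `bᵢ` maps the linear
extensions with `a` in the gap right above `bᵢ` injectively to those with `a` in the gap right
below `bᵢ`, so no gap is more likely than the lowest one (`countExt_gap_le`). If the lowest gap
has probability at least one third, then `a` and `b` are balanced. Otherwise the probability that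
`a` precedes `bᵢ` grows with `i`, in steps of less than one third, from below one third to above
two thirds, and it is balanced for some `i` (`exists_isBalancedPair_of_two_mul_le`).
-/

namespace OrderedSet

open SimpleGraph

/-! ### Order duality -/

section Duality

variable {V : Type*} [PartialOrder V]

/-- No pair of elements is very good. This is assumed, towards a contradiction, throughout the
structural analysis of the cover graph. -/
def VeryGoodFree (V : Type*) [PartialOrder V] : Prop :=
  ∀ a b : V, ¬ IsVeryGoodPair a b

theorem isChain_dual_iff {s : Set V} :
    IsChain (α := Vᵒᵈ) (· ≤ ·) (OrderDual.ofDual ⁻¹' s) ↔ IsChain (· ≤ ·) s :=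
  ⟨fun h _ hx _ hy hxy ↦ (h hx hy hxy).symm, fun h _ hx _ hy hxy ↦ (h hx hy hxy).symm⟩

theorem isChain_of_total {s : Set V} (h : ∀ x ∈ s, ∀ y ∈ s, x ≤ y ∨ y ≤ x) :
    IsChain (· ≤ ·) s := fun x hx y hy _ ↦ h x hx y hy

theorem isUpwardVeryGood_toDual_iff {a b : V} :
    IsUpwardVeryGood (OrderDual.toDual a) (OrderDual.toDual b) ↔
      Set.Ioi a = Set.Ioi b ∧ IsChain (· ≤ ·) (Set.Iio a \ Set.Iio b) ∧
        IsChain (· ≤ ·) (Set.Iio b \ Set.Iio a) :=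
  and_congr Iff.rfl (and_congr (isChain_dual_iff (s := Set.Iio a \ Set.Iio b))
    (isChain_dual_iff (s := Set.Iio b \ Set.Iio a)))

theorem VeryGoodFree.dual (h : VeryGoodFree V) : VeryGoodFree Vᵒᵈ := fun a b hab ↦
  h (OrderDual.ofDual a) (OrderDual.ofDual b) ⟨fun h' ↦ hab.1 h', hab.2.symm.imp id id⟩

theorem VeryGoodFree.false_up (h : VeryGoodFree V) {a b : V} (hne : a ≠ b)
    (hD : Set.Iio a = Set.Iio b) (h1 : IsChain (· ≤ ·) (Set.Ioi a \ Set.Ioi b))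
    (h2 : IsChain (· ≤ ·) (Set.Ioi b \ Set.Ioi a)) : False :=
  h a b ⟨hne, Or.inl ⟨hD, h1, h2⟩⟩

theorem VeryGoodFree.false_down (h : VeryGoodFree V) {a b : V} (hne : a ≠ b)
    (hU : Set.Ioi a = Set.Ioi b) (h1 : IsChain (· ≤ ·) (Set.Iio a \ Set.Iio b))
    (h2 : IsChain (· ≤ ·) (Set.Iio b \ Set.Iio a)) : False :=
  h a b ⟨hne, Or.inr (isUpwardVeryGood_toDual_iff.2 ⟨hU, h1, h2⟩)⟩

theorem hasse_dual_isAcyclic (h : (hasse V).IsAcyclic) : (hasse Vᵒᵈ).IsAcyclic :=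
  hasseDualIso.isAcyclic_iff.2 h

end Duality

/-! ### The two sides of an edge of the cover graph -/

section Sides

variable {V : Type*} [PartialOrder V]

/-- The side of `v` of the edge `rv` of the cover graph: the elements that can still be reached
from `v` when the edge between `r` and `v` is deleted. It is meant for adjacent `r` and `v`. -/
def side (r v : V) : Set V :=
  {z | ((hasse V).deleteEdges {s(r, v)}).Reachable v z}

theorem toDual_mem_side_iff {r v z : V} :
    OrderDual.toDual z ∈ side (OrderDual.toDual r) (OrderDual.toDual v) ↔ z ∈ side r v := by
  have h : (hasse Vᵒᵈ : SimpleGraph V) = hasse V := by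
    ext x y
    exact ((hasseDualIso (α := V)).map_rel_iff' (a := x) (b := y)).symm
  change ((SimpleGraph.deleteEdges (V := V) (hasse Vᵒᵈ) {s(r, v)}).Reachable v z) ↔ _
  rw [h]
  rfl

theorem self_mem_side (r v : V) : v ∈ side r v :=
  Reachable.refl v

theorem mem_side_or_of_adj {r v z y : V} (hz : z ∈ side r v) (h : (hasse V).Adj z y) :
    y ∈ side r v ∨ z = v ∧ y = r := by
  by_cases he : s(z, y) = s(r, v)
  · rcases Sym2.eq_iff.1 he with ⟨-, rfl⟩ | h'
    · exact Or.inl (self_mem_side _ _)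
    · exact Or.inr h'
  · refine Or.inl (Reachable.trans hz (Adj.reachable ?_))
    rw [deleteEdges_adj]
    exact ⟨h, he⟩

theorem side_induction {r v : V} {p : V → Prop} (hv : p v)
    (h : ∀ z y, z ∈ side r v → y ∈ side r v → (hasse V).Adj z y → p z → p y) :
    ∀ z ∈ side r v, p z := by
  intro z hz
  have hz' := (reachable_iff_reflTransGen _ _).1 hz
  induction hz' with
  | refl => exact hv
  | @tail x y hx hxy ih =>
    have hx' : x ∈ side r v := (reachable_iff_reflTransGen _ _).2 hx
    exact h x y hx' hz ((deleteEdges_adj).1 hxy).1 (ih hx')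

/-- Every edge of a forest is a bridge. -/
theorem notMem_side (hF : (hasse V).IsAcyclic) {r v : V} (h : (hasse V).Adj r v) :
    r ∉ side r v := fun hr ↦
  isBridge_iff.1 (isAcyclic_iff_forall_adj_isBridge.1 hF h) (Reachable.symm hr)

/-- Two different edges, each lying outside the side of the other, have disjoint sides. -/
theorem disjoint_side {r u v w : V} (hvw : (hasse V).Adj v w) (hr : r ∉ side v w)
    (hv : v ∉ side r u) (hne : v = r → w ≠ u) : Disjoint (side v w) (side r u) := by
  rw [Set.disjoint_left]
  refine side_induction (fun hw ↦ ?_) fun z y hz' _ hzy hz hy' ↦ ?_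
  · rcases mem_side_or_of_adj hw hvw.symm with h | ⟨h1, h2⟩
    · exact hv h
    · exact hne h2 h1
  · rcases mem_side_or_of_adj hy' hzy.symm with h | ⟨-, h2⟩
    · exact hz h
    · -- the edge `zy` would be `ru`, with `z = r` on the side of `w`
      exact hr (h2 ▸ hz')

theorem disjoint_side_of_ne (hF : (hasse V).IsAcyclic) {v w w' : V} (hw : (hasse V).Adj v w)
    (hw' : (hasse V).Adj v w') (hne : w ≠ w') : Disjoint (side v w) (side v w') :=
  disjoint_side hw (notMem_side hF hw) (notMem_side hF hw') fun _ ↦ hne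

theorem side_subset_side {r u v w : V} (hvw : (hasse V).Adj v w) (hv : v ∈ side r u)
    (hr : r ∉ side v w) : side v w ⊆ side r u := by
  refine side_induction ?_ fun z y _ hy hzy hz ↦ ?_
  · rcases mem_side_or_of_adj hv hvw with h | ⟨-, h2⟩
    · exact h
    · exact absurd (h2 ▸ self_mem_side v w) hr
  · rcases mem_side_or_of_adj hz hzy with h | ⟨-, h2⟩
    · exact h
    · exact absurd (h2 ▸ hy) hr

variable [Finite V]

/-- A comparability leaving a side upwards passes through its edge. -/
theorem covBy_of_le_of_notMem_side {r v z y : V} (hz : z ∈ side r v) (hy : y ∉ side r v)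
    (h : z ≤ y) : v ⋖ r ∧ z ≤ v ∧ r ≤ y := by
  induction z using WellFoundedGT.induction with
  | ind z ih =>
    have hlt : z < y := lt_of_le_of_ne h fun e ↦ hy (e ▸ hz)
    obtain ⟨w, hzw, hwy⟩ := exists_covBy_le_of_lt hlt
    rcases mem_side_or_of_adj hz (Or.inl hzw) with hw | ⟨rfl, rfl⟩
    · obtain ⟨h1, h2, h3⟩ := ih w hzw.lt hw hwy
      exact ⟨h1, hzw.le.trans h2, h3⟩
    · exact ⟨hzw, le_rfl, hwy⟩

/-- A comparability entering a side upwards passes through its edge. -/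
theorem covBy_of_le_of_mem_side {r v z y : V} (hz : z ∈ side r v) (hy : y ∉ side r v)
    (h : y ≤ z) : r ⋖ v ∧ y ≤ r ∧ v ≤ z := by
  induction z using WellFoundedLT.induction with
  | ind z ih =>
    have hlt : y < z := lt_of_le_of_ne h fun e ↦ hy (e ▸ hz)
    obtain ⟨w, hyw, hwz⟩ := exists_le_covBy_of_lt hlt
    rcases mem_side_or_of_adj hz (Or.inr hwz) with hw | ⟨rfl, rfl⟩
    · obtain ⟨h1, h2, h3⟩ := ih w hwz.lt hw hyw
      exact ⟨h1, h2, h3.trans hwz.le⟩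
    · exact ⟨hwz, hyw, le_rfl⟩

theorem Ici_subset_side {r v : V} (h : r ⋖ v) : Set.Ici v ⊆ side r v := fun _ hz ↦
  by_contra fun hn ↦
    (covBy_of_le_of_notMem_side (self_mem_side r v) hn hz).1.lt.asymm h.lt

theorem Iic_subset_side {r v : V} (h : v ⋖ r) : Set.Iic v ⊆ side r v := fun _ hz ↦
  by_contra fun hn ↦
    (covBy_of_le_of_mem_side (self_mem_side r v) hn hz).1.lt.asymm h.lt

/-! ### Intervals and cones in an ordered set whose cover graph is a forest -/

/-- Upward paths from `v` through different covers never meet again. -/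
theorem eq_of_covBy_of_le (hF : (hasse V).IsAcyclic) {v c c' z : V} (hc : v ⋖ c) (hc' : v ⋖ c')
    (h : c ≤ z) (h' : c' ≤ z) : c = c' :=
  by_contra fun hne ↦ Set.disjoint_left.1
    (disjoint_side_of_ne hF (Or.inl hc) (Or.inl hc') hne)
    (Ici_subset_side hc h) (Ici_subset_side hc' h')

theorem isChain_Icc (hF : (hasse V).IsAcyclic) (a b : V) :
    IsChain (· ≤ ·) (Set.Icc a b) := by
  induction a using WellFoundedGT.induction with
  | ind a ih =>
    intro z hz z' hz' hne
    rcases hz.1.eq_or_lt with rfl | h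
    · exact Or.inl hz'.1
    rcases hz'.1.eq_or_lt with rfl | h'
    · exact Or.inr hz.1
    obtain ⟨c, hc, hcz⟩ := exists_covBy_le_of_lt h
    obtain ⟨c', hc', hcz'⟩ := exists_covBy_le_of_lt h'
    obtain rfl := eq_of_covBy_of_le hF hc hc' (hcz.trans hz.2) (hcz'.trans hz'.2)
    exact ih c hc.lt ⟨hcz, hz.2⟩ ⟨hcz', hz'.2⟩ hne

theorem isChain_Ici_of_covBy_unique {a : V}
    (h : ∀ u f f', a ≤ u → u ⋖ f → u ⋖ f' → f = f') : IsChain (· ≤ ·) (Set.Ici a) := by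
  induction a using WellFoundedGT.induction with
  | ind a ih =>
    intro z hz z' hz' hne
    rcases (Set.mem_Ici.1 hz).eq_or_lt with rfl | h1
    · exact Or.inl hz'
    rcases (Set.mem_Ici.1 hz').eq_or_lt with rfl | h2
    · exact Or.inr hz
    obtain ⟨c, hc, hcz⟩ := exists_covBy_le_of_lt h1
    obtain ⟨c', hc', hcz'⟩ := exists_covBy_le_of_lt h2
    obtain rfl := h a c c' le_rfl hc hc'
    exact ih c hc.lt (fun u f f' hu ↦ h u f f' (hc.le.trans hu)) hcz hcz' hne

/-- If nothing branches off upwards on the way from `a` up to `b`, then all elements above `a`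
are comparable with `b`. -/
theorem le_or_ge_of_covBy_le {a b z : V} (hab : a ≤ b)
    (h : ∀ u f, a ≤ u → u < b → u ⋖ f → f ≤ b) (hz : a ≤ z) : z ≤ b ∨ b ≤ z := by
  induction a using WellFoundedGT.induction with
  | ind a ih =>
    rcases hab.eq_or_lt with rfl | h1
    · exact Or.inr hz
    rcases hz.eq_or_lt with rfl | h2
    · exact Or.inl hab
    obtain ⟨c, hc, hcz⟩ := exists_covBy_le_of_lt h2
    exact ih c hc.lt (h a c le_rfl h1 hc) (fun u f hu ↦ h u f (hc.le.trans hu)) hcz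

/-- If nothing branches off downwards on the way from `b` down to `a`, then all elements below
`b` are comparable with `a`. -/
theorem le_or_ge_of_le_covBy {a b z : V} (hab : a ≤ b)
    (h : ∀ u f, a < u → u ≤ b → f ⋖ u → a ≤ f) (hz : z ≤ b) : z ≤ a ∨ a ≤ z := by
  induction b using WellFoundedLT.induction with
  | ind b ih =>
    rcases hab.eq_or_lt with rfl | h1
    · exact Or.inl hz
    rcases hz.eq_or_lt with rfl | h2
    · exact Or.inr hab
    obtain ⟨c, hzc, hc⟩ := exists_le_covBy_of_lt h2
    exact ih c hc.lt (h b c h1 le_rfl hc) (fun u f hu hu' ↦ h u f hu (hu'.trans hc.le)) hzc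

end Sides

/-! ### Tails and ends -/

section Tails

variable {V : Type*} [PartialOrder V]

/-- The edge from `r` up to `v` carries an upward tail: the side of `v` is a chain with least
element `v`, so that it is the set of all elements above `v`. -/
def IsUpTail (r v : V) : Prop :=
  r ⋖ v ∧ IsChain (· ≤ ·) (side r v) ∧ ∀ z ∈ side r v, v ≤ z

/-- The edge from `r` down to `v` carries a downward tail: the side of `v` is a chain with
greatest element `v`. -/
def IsDownTail (r v : V) : Prop :=
  v ⋖ r ∧ IsChain (· ≤ ·) (side r v) ∧ ∀ z ∈ side r v, z ≤ v

/-- A minimal element whose up-set is a chain. -/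
def IsLowEnd (a : V) : Prop :=
  IsMin a ∧ IsChain (· ≤ ·) (Set.Ici a)

/-- A maximal element whose down-set is a chain. -/
def IsHighEnd (a : V) : Prop :=
  IsMax a ∧ IsChain (· ≤ ·) (Set.Iic a)

theorem isDownTail_toDual_iff {r v : V} :
    IsDownTail (OrderDual.toDual r) (OrderDual.toDual v) ↔ IsUpTail r v := by
  have hs : side (OrderDual.toDual r) (OrderDual.toDual v) = OrderDual.ofDual ⁻¹' side r v := by
    ext z
    exact toDual_mem_side_iff
  unfold IsDownTail IsUpTail
  rw [hs, isChain_dual_iff, toDual_covBy_toDual_iff]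
  rfl

theorem isUpTail_toDual_iff {r v : V} :
    IsUpTail (OrderDual.toDual r) (OrderDual.toDual v) ↔ IsDownTail r v := by
  have hs : side (OrderDual.toDual r) (OrderDual.toDual v) = OrderDual.ofDual ⁻¹' side r v := by
    ext z
    exact toDual_mem_side_iff
  unfold IsDownTail IsUpTail
  rw [hs, isChain_dual_iff, toDual_covBy_toDual_iff]
  rfl

theorem isLowEnd_toDual_iff {a : V} : IsLowEnd (OrderDual.toDual a) ↔ IsHighEnd a :=
  and_congr isMin_toDual_iff (isChain_dual_iff (s := Set.Iic a))

theorem isHighEnd_toDual_iff {a : V} : IsHighEnd (OrderDual.toDual a) ↔ IsLowEnd a :=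
  and_congr isMax_toDual_iff (isChain_dual_iff (s := Set.Ici a))

theorem IsLowEnd.eq (hP : VeryGoodFree V) {a b : V} (ha : IsLowEnd a) (hb : IsLowEnd b) :
    a = b :=
  by_contra fun hne ↦ hP.false_up hne (ha.1.Iio_eq.trans hb.1.Iio_eq.symm)
    (ha.2.mono fun _ h ↦ le_of_lt h.1) (hb.2.mono fun _ h ↦ le_of_lt h.1)

theorem IsHighEnd.eq (hP : VeryGoodFree V) {a b : V} (ha : IsHighEnd a) (hb : IsHighEnd b) :
    a = b :=
  by_contra fun hne ↦ hP.false_down hne (ha.1.Ioi_eq.trans hb.1.Ioi_eq.symm)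
    (ha.2.mono fun _ h ↦ le_of_lt h.1) (hb.2.mono fun _ h ↦ le_of_lt h.1)

variable [Finite V]

theorem IsUpTail.Iio_eq {r v : V} (h : IsUpTail r v) : Set.Iio v = Set.Iic r := by
  ext z
  refine ⟨fun hz ↦ ?_, fun hz ↦ lt_of_le_of_lt hz h.1.lt⟩
  by_cases hs : z ∈ side r v
  · exact absurd hz (h.2.2 z hs).not_gt
  · exact (covBy_of_le_of_mem_side (self_mem_side r v) hs (le_of_lt hz)).2.1

theorem IsDownTail.Ioi_eq {r v : V} (h : IsDownTail r v) : Set.Ioi v = Set.Ici r := by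
  ext z
  refine ⟨fun hz ↦ ?_, fun hz ↦ lt_of_lt_of_le h.1.lt hz⟩
  by_cases hs : z ∈ side r v
  · exact absurd hz (h.2.2 z hs).not_gt
  · exact (covBy_of_le_of_notMem_side (self_mem_side r v) hs (le_of_lt hz)).2.2

theorem IsUpTail.isChain_Ici {r v : V} (h : IsUpTail r v) : IsChain (· ≤ ·) (Set.Ici v) :=
  h.2.1.mono (Ici_subset_side h.1)

theorem IsDownTail.isChain_Iic {r v : V} (h : IsDownTail r v) : IsChain (· ≤ ·) (Set.Iic v) :=
  h.2.1.mono (Iic_subset_side h.1)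

/-- At most one upward tail is attached to each element. -/
theorem IsUpTail.eq (hP : VeryGoodFree V) {r v w : V} (hv : IsUpTail r v) (hw : IsUpTail r w) :
    v = w :=
  by_contra fun hne ↦ hP.false_up hne (hv.Iio_eq.trans hw.Iio_eq.symm)
    (hv.isChain_Ici.mono fun _ h ↦ le_of_lt h.1) (hw.isChain_Ici.mono fun _ h ↦ le_of_lt h.1)

/-- At most one downward tail is attached to each element. -/
theorem IsDownTail.eq (hP : VeryGoodFree V) {r v w : V} (hv : IsDownTail r v)
    (hw : IsDownTail r w) : v = w :=
  by_contra fun hne ↦ hP.false_down hne (hv.Ioi_eq.trans hw.Ioi_eq.symm)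
    (hv.isChain_Iic.mono fun _ h ↦ le_of_lt h.1) (hw.isChain_Iic.mono fun _ h ↦ le_of_lt h.1)

theorem exists_isMin_le (v : V) : ∃ a ≤ v, IsMin a := by
  obtain ⟨a, ha, hmin⟩ := (Set.toFinite (Set.Iic v)).exists_minimal ⟨v, le_rfl⟩
  exact ⟨a, ha, fun z hz ↦ hmin (hz.trans ha) hz⟩

theorem exists_isMax_ge (v : V) : ∃ a, v ≤ a ∧ IsMax a := by
  obtain ⟨a, ha, hmax⟩ := (Set.toFinite (Set.Ici v)).exists_maximal ⟨v, le_rfl⟩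
  exact ⟨a, ha, fun z hz ↦ hmax (le_trans ha hz) hz⟩

theorem le_of_mem_side_or_ge {r v a z : V} (ha : a ∈ side r v) (hz : a ≤ z) :
    z ∈ side r v ∨ r ≤ z :=
  (em _).imp_right fun h ↦ (covBy_of_le_of_notMem_side ha h hz).2.2

/-- If the up-set of `r` is a chain, a downward tail at `r` ends in a low end. -/
theorem IsDownTail.exists_isLowEnd {r v : V} (h : IsDownTail r v)
    (hr : IsChain (· ≤ ·) (Set.Ici r)) : ∃ a ∈ side r v, IsLowEnd a := by
  obtain ⟨a, hav, ha⟩ := exists_isMin_le v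
  have has := Iic_subset_side h.1 hav
  refine ⟨a, has, ha, isChain_of_total fun x hx y hy ↦ ?_⟩
  rcases le_of_mem_side_or_ge has hx with hx | hx <;>
    rcases le_of_mem_side_or_ge has hy with hy | hy
  · exact h.2.1.total hx hy
  · exact Or.inl ((h.2.2 x hx).trans (h.1.le.trans hy))
  · exact Or.inr ((h.2.2 y hy).trans (h.1.le.trans hx))
  · exact hr.total hx hy

theorem IsUpTail.exists_isHighEnd {r v : V} (h : IsUpTail r v)
    (hr : IsChain (· ≤ ·) (Set.Iic r)) : ∃ a ∈ side r v, IsHighEnd a := by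
  obtain ⟨a, ha, ha'⟩ := (isDownTail_toDual_iff.2 h).exists_isLowEnd
    (isChain_dual_iff (s := Set.Iic r) |>.2 hr)
  exact ⟨OrderDual.ofDual a, toDual_mem_side_iff.1 ha, isLowEnd_toDual_iff.1 ha'⟩

/-- If all lower covers of `v` are attached as tails, then there is at most one of them. -/
theorem isChain_Iic_of_isDownTail (hP : VeryGoodFree V) {v : V}
    (h : ∀ w, w ⋖ v → IsDownTail v w) : IsChain (· ≤ ·) (Set.Iic v) := by
  refine isChain_of_total fun x hx y hy ↦ ?_
  rcases (Set.mem_Iic.1 hx).eq_or_lt with rfl | hx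
  · exact Or.inr hy
  rcases (Set.mem_Iic.1 hy).eq_or_lt with rfl | hy
  · exact Or.inl hx.le
  obtain ⟨w, hxw, hw⟩ := exists_le_covBy_of_lt hx
  obtain ⟨w', hyw, hw'⟩ := exists_le_covBy_of_lt hy
  obtain rfl := (h w hw).eq hP (h w' hw')
  exact (h w hw).isChain_Iic.total hxw hyw

theorem isChain_Ici_of_isUpTail (hP : VeryGoodFree V) {v : V}
    (h : ∀ w, v ⋖ w → IsUpTail v w) : IsChain (· ≤ ·) (Set.Ici v) :=
  isChain_dual_iff (s := Set.Ici v) |>.1 <|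
    isChain_Iic_of_isDownTail hP.dual (v := OrderDual.toDual v) fun w hw ↦
      isDownTail_toDual_iff.2 (h (OrderDual.ofDual w) (toDual_covBy_toDual_iff.1 hw))

/-- One step of the induction in `isTail_or_exists_isEnd`, for an edge going down to `v`. -/
theorem isDownTail_or_exists_isEnd_of_forall (hF : (hasse V).IsAcyclic) (hP : VeryGoodFree V)
    {r v : V} (hvr : v ⋖ r)
    (ih : ∀ w, w ≠ r → (hasse V).Adj v w →
      (IsUpTail v w ∨ IsDownTail v w) ∨ ∃ e ∈ side v w, IsLowEnd e ∨ IsHighEnd e) :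
    IsDownTail r v ∨ ∃ e ∈ side r v, IsLowEnd e ∨ IsHighEnd e := by
  by_contra! hcon
  obtain ⟨hnt, hne⟩ := hcon
  have hsub : ∀ w, w ≠ r → (hasse V).Adj v w → side v w ⊆ side r v := fun w hw hadj ↦
    side_subset_side hadj (self_mem_side r v) fun hr ↦
      Set.disjoint_left.1 (disjoint_side_of_ne hF hadj (Or.inl hvr) hw) hr (self_mem_side v r)
  have htail : ∀ w, w ≠ r → (hasse V).Adj v w → IsUpTail v w ∨ IsDownTail v w :=
    fun w hw hadj ↦ (ih w hw hadj).resolve_right fun ⟨e, he, he'⟩ ↦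
      he'.elim (hne e (hsub w hw hadj he)).1 (hne e (hsub w hw hadj he)).2
  have hdown : ∀ w, w ⋖ v → IsDownTail v w := fun w hw ↦
    (htail w (fun h ↦ (h ▸ hw).lt.asymm hvr.lt) (Or.inr hw)).resolve_left
      fun h ↦ h.1.lt.asymm hw.lt
  have hchain := isChain_Iic_of_isDownTail hP hdown
  by_cases hup : ∃ c, v ⋖ c ∧ c ≠ r
  · obtain ⟨c, hc, hcr⟩ := hup
    have hct : IsUpTail v c := (htail c hcr (Or.inl hc)).resolve_right
      fun h ↦ h.1.lt.asymm hc.lt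
    obtain ⟨e, he, he'⟩ := hct.exists_isHighEnd hchain
    exact (hne e (hsub c hcr (Or.inl hc) he)).2 he'
  · push Not at hup
    have hle : ∀ z ∈ side r v, z ≤ v := by
      refine side_induction le_rfl fun z y _ hy hzy hz ↦ ?_
      rcases hzy with hzy | hzy
      · rcases hz.eq_or_lt with rfl | hlt
        · exact absurd (hup y hzy ▸ hy) (notMem_side hF (Or.inr hvr))
        · obtain ⟨w, hzw, hw⟩ := exists_le_covBy_of_lt hlt
          rcases mem_side_or_of_adj (Iic_subset_side hw hzw) (Or.inl hzy) with h | ⟨-, h⟩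
          · exact ((hdown w hw).2.2 y h).trans hw.le
          · exact h.le
      · exact hzy.le.trans hz
    exact hnt ⟨hvr, hchain.mono hle, hle⟩

/-- Every edge of the cover graph carries a tail, or has an end on its far side. -/
theorem isTail_or_exists_isEnd (hF : (hasse V).IsAcyclic) (hP : VeryGoodFree V)
    {r v : V} (hrv : (hasse V).Adj r v) :
    (IsUpTail r v ∨ IsDownTail r v) ∨ ∃ e ∈ side r v, IsLowEnd e ∨ IsHighEnd e := by
  induction hn : (side r v).ncard using Nat.strong_induction_on generalizing r v with
  | _ n ih =>
    subst hn
    have ih' : ∀ w, w ≠ r → (hasse V).Adj v w →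
        (IsUpTail v w ∨ IsDownTail v w) ∨ ∃ e ∈ side v w, IsLowEnd e ∨ IsHighEnd e := by
      refine fun w hw hadj ↦ ih _ (Set.ncard_lt_ncard ?_ (Set.toFinite _)) hadj rfl
      have hsub : side v w ⊆ side r v := side_subset_side hadj (self_mem_side r v) fun hr ↦
        Set.disjoint_left.1 (disjoint_side_of_ne hF hadj hrv.symm hw) hr (self_mem_side v r)
      exact (Set.ssubset_iff_of_subset hsub).2 ⟨v, self_mem_side r v, notMem_side hF hadj⟩
    rcases hrv with h | h
    · have ihd : ∀ w : Vᵒᵈ, w ≠ OrderDual.toDual r → (hasse Vᵒᵈ).Adj (OrderDual.toDual v) w →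
          (IsUpTail (OrderDual.toDual v) w ∨ IsDownTail (OrderDual.toDual v) w) ∨
            ∃ e ∈ side (OrderDual.toDual v) w, IsLowEnd e ∨ IsHighEnd e := by
        intro w hw hadj
        rcases ih' (OrderDual.ofDual w) hw (hadj.symm.imp
          toDual_covBy_toDual_iff.1 toDual_covBy_toDual_iff.1) with h' | ⟨e, he, he'⟩
        · exact Or.inl (h'.symm.imp isUpTail_toDual_iff.2 isDownTail_toDual_iff.2)
        · exact Or.inr ⟨OrderDual.toDual e, toDual_mem_side_iff.2 he,
            he'.symm.imp isLowEnd_toDual_iff.2 isHighEnd_toDual_iff.2⟩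
      rcases isDownTail_or_exists_isEnd_of_forall (hasse_dual_isAcyclic hF) hP.dual
        (toDual_covBy_toDual_iff.2 h) ihd with h' | ⟨e, he, he'⟩
      · exact Or.inl (Or.inl (isDownTail_toDual_iff.1 h'))
      · exact Or.inr ⟨OrderDual.ofDual e, toDual_mem_side_iff.1 he,
          he'.symm.imp isHighEnd_toDual_iff.1 isLowEnd_toDual_iff.1⟩
    · exact (isDownTail_or_exists_isEnd_of_forall hF hP h ih').imp_left Or.inr

/-- Every nonempty set that is closed under adjacency contains an end. -/
theorem exists_isEnd (hF : (hasse V).IsAcyclic) (hP : VeryGoodFree V) {s : Set V}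
    (hs : ∀ x ∈ s, ∀ y, (hasse V).Adj x y → y ∈ s) {r : V} (hr : r ∈ s) :
    ∃ e ∈ s, IsLowEnd e ∨ IsHighEnd e := by
  by_contra! hcon
  have hside : ∀ w, (hasse V).Adj r w → side r w ⊆ s := fun w hw ↦
    side_induction (hs r hr w hw) fun z y _ _ hzy hz ↦ hs z hz y hzy
  have htail : ∀ w, (hasse V).Adj r w → IsUpTail r w ∨ IsDownTail r w := fun w hw ↦
    (isTail_or_exists_isEnd hF hP hw).resolve_right fun ⟨e, he, he'⟩ ↦
      he'.elim (hcon e (hside w hw he)).1 (hcon e (hside w hw he)).2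
  have hdown : ∀ w, w ⋖ r → IsDownTail r w := fun w hw ↦
    (htail w (Or.inr hw)).resolve_left fun h ↦ h.1.lt.asymm hw.lt
  have hup : ∀ w, r ⋖ w → IsUpTail r w := fun w hw ↦
    (htail w (Or.inl hw)).resolve_right fun h ↦ h.1.lt.asymm hw.lt
  by_cases h : ∃ w, w ⋖ r
  · obtain ⟨w, hw⟩ := h
    obtain ⟨e, he, he'⟩ := (hdown w hw).exists_isLowEnd (isChain_Ici_of_isUpTail hP hup)
    exact (hcon e (hside w (Or.inr hw) he)).1 he'
  · refine (hcon r hr).1 ⟨fun z hz ↦ ?_, isChain_Ici_of_isUpTail hP hup⟩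
    rcases hz.eq_or_lt with rfl | hlt
    · exact le_rfl
    · obtain ⟨w, -, hw⟩ := exists_le_covBy_of_lt hlt
      exact absurd ⟨w, hw⟩ h

end Tails

/-! ### The cover graph around a low end -/

section LowEnds

variable {V : Type*} [PartialOrder V]

/-- The situation around a low end `α` when no pair is very good: going up from `α`, the first
and only element with a further lower cover is `q`, where the chain from `α` arrives through `e`
and the further lower cover is `p`; this is encoded by `le_or_le`, which says that whatever lies
below an element above `α` is above `α` or below `p`. Beyond `p` lies the only other end `β`, a
high one. -/
structure IsLowBranch (α e q p β : V) : Prop where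
  isLowEnd : IsLowEnd α
  isHighEnd : IsHighEnd β
  le : α ≤ e
  covBy : p ⋖ q
  not_le : ¬ α ≤ p
  isDownTail : IsDownTail q e
  le_or_le : ∀ u z, α ≤ u → z ≤ u → α ≤ z ∨ z ≤ p
  high_mem : β ∈ side q p
  low_notMem : α ∉ side q p

namespace IsLowBranch

variable {α e q p β : V}

theorem lt_right (hB : IsLowBranch α e q p β) : α < q :=
  hB.le.trans_lt hB.isDownTail.1.lt

theorem isChain_Ici (hB : IsLowBranch α e q p β) : IsChain (· ≤ ·) (Set.Ici q) :=
  hB.isLowEnd.2.mono (Set.Ici_subset_Ici.2 hB.lt_right.le)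

/-- A maximal element `b` above `p` but not above `q` is no partner in the dual for a maximal
element `x` above `q`, although what lies below `x` but not below `b` is a chain. -/
theorem not_isChain (hB : IsLowBranch α e q p β) (hP : VeryGoodFree V) {x b : V}
    (hqx : q ≤ x) (hx : IsMax x) (hpb : p ≤ b) (hqb : ¬ q ≤ b) (hb : IsMax b) :
    ¬ IsChain (· ≤ ·) (Set.Iio b \ Set.Iio x) := fun hch ↦ by
  refine hP.false_down (a := x) (b := b) (fun h ↦ hqb (h ▸ hqx))
    (hx.Ioi_eq.trans hb.Ioi_eq.symm) (hB.isLowEnd.2.mono fun z hz ↦ ?_) hch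
  refine (hB.le_or_le x z (hB.lt_right.le.trans hqx) (le_of_lt hz.1)).resolve_right fun h ↦ ?_
  refine hz.2 (lt_of_le_of_ne (h.trans hpb) fun h' ↦ ?_)
  exact hb.not_lt ((h' ▸ h).trans_lt hB.covBy.lt)

theorem side_subset_of_covBy (hB : IsLowBranch α e q p β) (hF : (hasse V).IsAcyclic) {d : V}
    (hd : p ⋖ d) (hdq : d ≠ q) : side p d ⊆ side q p :=
  side_subset_side (Or.inl hd) (self_mem_side q p) fun h ↦
    Set.disjoint_left.1 (disjoint_side_of_ne hF (Or.inl hd) (Or.inl hB.covBy) hdq) h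
      (self_mem_side p q)

end IsLowBranch

variable [Finite V]

theorem isTail_or_exists_isHighEnd (hF : (hasse V).IsAcyclic) (hP : VeryGoodFree V) {α v w : V}
    (hα : IsLowEnd α) (hvw : (hasse V).Adj v w) (hn : α ∉ side v w) :
    (IsUpTail v w ∨ IsDownTail v w) ∨ ∃ β ∈ side v w, IsHighEnd β :=
  (isTail_or_exists_isEnd hF hP hvw).imp_right fun ⟨e, he, he'⟩ ↦
    ⟨e, he, he'.resolve_left fun h ↦ hn (hα.eq hP h ▸ he)⟩

theorem notMem_side_of_not_le (hF : (hasse V).IsAcyclic) {α u f : V}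
    (hu : α ≤ u) (hf : f ⋖ u) (hn : ¬ α ≤ f) : α ∉ side u f := fun h ↦
  hn (covBy_of_le_of_notMem_side h (notMem_side hF (Or.inr hf)) hu).2.1

/-- A branch hanging off the chain above a low end is no tail, since its bottom would be a second
low end; so it contains a high end. -/
theorem IsLowEnd.exists_isHighEnd (hF : (hasse V).IsAcyclic) (hP : VeryGoodFree V) {α u f : V}
    (hα : IsLowEnd α) (hu : α ≤ u) (hf : f ⋖ u) (hn : ¬ α ≤ f) :
    ∃ β ∈ side u f, IsHighEnd β := by
  have hα' := notMem_side_of_not_le hF hu hf hn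
  refine (isTail_or_exists_isHighEnd hF hP hα (Or.inr hf) hα').resolve_left fun h ↦ ?_
  rcases h with h | h
  · exact h.1.lt.asymm hf.lt
  · obtain ⟨a, ha, ha'⟩ := h.exists_isLowEnd (hα.2.mono (Set.Ici_subset_Ici.2 hu))
    exact hα' (hα.eq hP ha' ▸ ha)

/-- Unless the order is total, something hangs off the chain above a low end. -/
theorem IsLowEnd.exists_covBy (hF : (hasse V).IsAcyclic) (hP : VeryGoodFree V)
    (hnt : ¬ ∀ x y : V, x ≤ y ∨ y ≤ x) {α : V} (hα : IsLowEnd α) :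
    ∃ q p, α ≤ q ∧ p ⋖ q ∧ ¬ α ≤ p := by
  by_contra! hcon
  obtain ⟨x, hαx, hx⟩ := exists_isMax_ge α
  have hxβ : IsHighEnd x := by
    refine ⟨hx, hα.2.mono fun z hz ↦ ?_⟩
    rcases le_or_ge_of_le_covBy hαx (fun u f hu _ ↦ hcon u f hu.le) hz with h | h
    · exact hα.1 h
    · exact h
  obtain ⟨r, hr⟩ : ∃ r, ¬ α ≤ r := by
    by_contra! hall
    exact hnt fun x y ↦ hα.2.total (hall x) (hall y)
  obtain ⟨e, he, he'⟩ := exists_isEnd hF hP (s := (Set.Ici α)ᶜ) (fun x hx y hxy hy ↦ hx <| by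
    rcases hxy with h | h
    · exact hcon y x hy h
    · exact le_trans hy h.le) hr
  rcases he' with h | h
  · exact he (hα.eq hP h).le
  · exact he (hxβ.eq hP h ▸ hαx)

/-- What hangs off the chain above a low end hangs at a single place, for each such branch contains
the only high end. -/
theorem IsLowEnd.covBy_unique (hF : (hasse V).IsAcyclic) (hP : VeryGoodFree V) {α u f u' f' : V}
    (hα : IsLowEnd α) (hu : α ≤ u) (hf : f ⋖ u) (hn : ¬ α ≤ f) (hu' : α ≤ u') (hf' : f' ⋖ u')
    (hn' : ¬ α ≤ f') : u = u' ∧ f = f' := by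
  obtain ⟨β, hβ, hβe⟩ := hα.exists_isHighEnd hF hP hu hf hn
  obtain ⟨β', hβ', hβe'⟩ := hα.exists_isHighEnd hF hP hu' hf' hn'
  obtain rfl := hβe.eq hP hβe'
  have key : ∀ {u f u' : V}, α ≤ u → f ⋖ u → ¬ α ≤ f → α ≤ u' → u' ∉ side u f :=
    fun hu hf hn hu' h ↦ (covBy_of_le_of_mem_side h
      (notMem_side_of_not_le hF hu hf hn) hu').1.lt.asymm hf.lt
  by_contra hne
  exact Set.disjoint_left.1 (disjoint_side (Or.inr hf) (key hu hf hn hu')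
    (key hu' hf' hn' hu) fun h h' ↦ hne ⟨h, h'⟩) hβ hβ'

theorem IsLowEnd.exists_isLowBranch (hF : (hasse V).IsAcyclic) (hP : VeryGoodFree V)
    (hnt : ¬ ∀ x y : V, x ≤ y ∨ y ≤ x) {α : V} (hα : IsLowEnd α) :
    ∃ e q p β, IsLowBranch α e q p β := by
  obtain ⟨q, p, hq, hp, hn⟩ := hα.exists_covBy hF hP hnt
  obtain ⟨β, hβ, hβe⟩ := hα.exists_isHighEnd hF hP hq hp hn
  have huniq : ∀ u f, α ≤ u → f ⋖ u → ¬ α ≤ f → u = q ∧ f = p := fun u f hu hf hnf ↦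
    hα.covBy_unique hF hP hu hf hnf hq hp hn
  have hlt : α < q := lt_of_le_of_ne hq fun h ↦ hα.1.not_lt (h ▸ hp.lt)
  obtain ⟨e, he, heq⟩ := exists_le_covBy_of_lt hlt
  have hside : ∀ z ∈ side q e, α ≤ z ∧ z ≤ e := by
    refine side_induction ⟨he, le_rfl⟩ fun z y hz hy hzy h ↦ ?_
    have hne : ∀ {w}, w ∈ side q e → w ≠ q := fun hw h ↦
      notMem_side hF (Or.inr heq) (h ▸ hw)
    rcases hzy with hzy | hzy
    · have hy' : α ≤ y := h.1.trans hzy.le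
      refine ⟨hy', ?_⟩
      rcases hα.2.total hy' he with h' | h'
      · exact h'
      rcases h.2.eq_or_lt with rfl | hze
      · refine absurd ?_ (hne hy)
        rcases hα.2.total hy' hq with h'' | h''
        · exact h''.eq_or_lt.resolve_right (heq.2 hzy.lt)
        · exact (h''.eq_or_lt.resolve_right (hzy.2 heq.lt)).symm
      · exact (h'.eq_or_lt.resolve_right fun h'' ↦ hzy.2 hze h'').ge
    · refine ⟨by_contra fun hny ↦ hne hz (huniq z y h.1 hzy hny).1, hzy.le.trans h.2⟩
  refine ⟨e, q, p, β, hα, hβe, he, hp, hn,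
    ⟨heq, hα.2.mono fun z hz ↦ (hside z hz).1, fun z hz ↦ (hside z hz).2⟩, ?_, hβ,
    notMem_side_of_not_le hF hq hp hn⟩
  intro u z hu hz
  induction u using WellFoundedLT.induction with
  | ind u ih =>
    rcases hz.eq_or_lt with rfl | hlt
    · exact Or.inl hu
    obtain ⟨f, hzf, hf⟩ := exists_le_covBy_of_lt hlt
    by_cases hαf : α ≤ f
    · exact ih f hf.lt hαf hzf
    · exact Or.inr ((huniq u f hu hf hαf).2 ▸ hzf)

namespace IsLowBranch

variable {α e q p β : V}

theorem isTail_or_mem_side (hB : IsLowBranch α e q p β) (hF : (hasse V).IsAcyclic)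
    (hP : VeryGoodFree V) {v w : V} (hvw : (hasse V).Adj v w) (hn : α ∉ side v w) :
    (IsUpTail v w ∨ IsDownTail v w) ∨ β ∈ side v w :=
  (isTail_or_exists_isHighEnd hF hP hB.isLowEnd hvw hn).imp_right fun ⟨_, hb, hb'⟩ ↦
    hB.isHighEnd.eq hP hb' ▸ hb

theorem isUpTail_or_mem_side (hB : IsLowBranch α e q p β) (hF : (hasse V).IsAcyclic)
    (hP : VeryGoodFree V) {v w : V} (hvw : v ⋖ w) (hn : α ∉ side v w) :
    IsUpTail v w ∨ β ∈ side v w :=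
  (hB.isTail_or_mem_side hF hP (Or.inl hvw) hn).imp_left fun h ↦
    h.resolve_right fun h' ↦ h'.1.lt.asymm hvw.lt

theorem isDownTail_or_mem_side (hB : IsLowBranch α e q p β) (hF : (hasse V).IsAcyclic)
    (hP : VeryGoodFree V) {v w : V} (hvw : w ⋖ v) (hn : α ∉ side v w) :
    IsDownTail v w ∨ β ∈ side v w :=
  (hB.isTail_or_mem_side hF hP (Or.inr hvw) hn).imp_left fun h ↦
    h.resolve_left fun h' ↦ h'.1.lt.asymm hvw.lt

theorem side_subset (hB : IsLowBranch α e q p β) (hF : (hasse V).IsAcyclic) {u f : V}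
    (hu : u ≤ p) (hf : f ⋖ u) : side u f ⊆ side q p :=
  side_subset_side (Or.inr hf) (Iic_subset_side hB.covBy hu) fun h ↦
    (covBy_of_le_of_mem_side h (notMem_side hF (Or.inr hf))
      (hu.trans hB.covBy.le)).1.lt.asymm hf.lt

/-- The case in which nothing but `q` covers `p`. Going down from `p`, let `v` be an element with
two upper covers `c ≤ p` and `c'`. If `c'` carries a tail, then `c` and `c'` form a very good
pair; otherwise everything below `p` is a chain, and `e` and `p` form one in the dual. -/
theorem false_of_forall_covBy (hB : IsLowBranch α e q p β) (hF : (hasse V).IsAcyclic)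
    (hP : VeryGoodFree V) (hpq : ∀ c, p ⋖ c → c = q) : False := by
  have hp : ¬ IsChain (· ≤ ·) (Set.Iic p) := fun hch ↦ by
    refine hP.false_down (a := e) (b := p) (fun h ↦ hB.not_le (h ▸ hB.le)) ?_
      (hB.isDownTail.isChain_Iic.mono fun _ h ↦ le_of_lt h.1) (hch.mono fun _ h ↦ le_of_lt h.1)
    rw [hB.isDownTail.Ioi_eq]
    ext z
    refine ⟨fun hz ↦ hB.covBy.lt.trans_le hz, fun hz ↦ ?_⟩
    obtain ⟨c, hc, hcz⟩ := exists_covBy_le_of_lt (Set.mem_Ioi.1 hz)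
    exact hpq c hc ▸ hcz
  have hq : q ∉ side q p := notMem_side hF (Or.inr hB.covBy)
  have hex : {v | v ≤ p ∧ ∃ c c', v ⋖ c ∧ v ⋖ c' ∧ c ≠ c'}.Nonempty := by
    by_contra! hcon
    have hcov : ∀ v c c', v ≤ p → v ⋖ c → v ⋖ c' → c = c' := fun v c c' hv hc hc' ↦
      by_contra fun hne ↦ (hcon.le ⟨hv, c, c', hc, hc', hne⟩ : v ∈ (∅ : Set V))
    have hle : ∀ z ∈ side q p, z ≤ p := by
      refine side_induction le_rfl fun z y _ hy hzy hz ↦ ?_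
      rcases hzy with hzy | hzy
      · rcases hz.eq_or_lt with rfl | hlt
        · exact absurd (hpq y hzy ▸ hy) hq
        · obtain ⟨g, hg, hgp⟩ := exists_covBy_le_of_lt hlt
          exact hcov z y g hz hzy hg ▸ hgp
      · exact hzy.le.trans hz
    exact hB.isHighEnd.1.not_lt ((hle β hB.high_mem).trans_lt hB.covBy.lt)
  obtain ⟨v, ⟨hvp, c₁, c₂, hc₁, hc₂, hc₁₂⟩, hmax⟩ := (Set.toFinite _).exists_maximal hex
  have hcov : ∀ u c c', v < u → u ≤ p → u ⋖ c → u ⋖ c' → c = c' := fun u c c' hu hup hc hc' ↦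
    by_contra fun hne ↦ hu.not_ge (hmax ⟨hup, c, c', hc, hc', hne⟩ hu.le)
  have hvlt : v < p := lt_of_le_of_ne hvp fun h ↦ by
    subst h
    exact hc₁₂ ((hpq c₁ hc₁).trans (hpq c₂ hc₂).symm)
  obtain ⟨c, hc, hcp⟩ := exists_covBy_le_of_lt hvlt
  obtain ⟨c', hc', hcc'⟩ : ∃ c', v ⋖ c' ∧ c ≠ c' := by
    by_cases h : c = c₁
    · exact ⟨c₂, hc₂, h ▸ hc₁₂⟩
    · exact ⟨c₁, hc₁, h⟩
  have hc'p : ¬ c' ≤ p := fun h ↦ hcc' (eq_of_covBy_of_le hF hc hc' hcp h)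
  have hIcip : IsChain (· ≤ ·) (Set.Ici p) := by
    refine isChain_of_total fun x hx y hy ↦ ?_
    rcases (Set.mem_Ici.1 hx).eq_or_lt with rfl | hx
    · exact Or.inl hy
    rcases (Set.mem_Ici.1 hy).eq_or_lt with rfl | hy
    · exact Or.inr hx.le
    obtain ⟨g, hg, hgx⟩ := exists_covBy_le_of_lt hx
    obtain ⟨g', hg', hgy⟩ := exists_covBy_le_of_lt hy
    exact hB.isChain_Ici.total (hpq g hg ▸ hgx) (hpq g' hg' ▸ hgy)
  have hIci : ∀ u, v < u → u ≤ p → IsChain (· ≤ ·) (Set.Ici u) := by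
    intro u hu hup
    have hcomp : ∀ z, u ≤ z → z ≤ p ∨ p ≤ z := fun z hz ↦
      le_or_ge_of_covBy_le hup (fun w f huw hwp hwf ↦ by
        obtain ⟨g, hg, hgp⟩ := exists_covBy_le_of_lt hwp
        exact hcov w f g (hu.trans_le huw) hwp.le hwf hg ▸ hgp) hz
    refine isChain_of_total fun x hx y hy ↦ ?_
    rcases hcomp x hx with h1 | h1 <;> rcases hcomp y hy with h2 | h2
    · exact (isChain_Icc hF u p).total ⟨hx, h1⟩ ⟨hy, h2⟩
    · exact Or.inl (h1.trans h2)
    · exact Or.inr (h2.trans h1)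
    · exact hIcip.total h1 h2
  -- A further lower cover `f` of some `u` in `(v, p]` would carry the high end, as would the
  -- lower cover `g` of `u` above `v`, because of `c'`.
  have hlow : ∀ u f, v < u → u ≤ p → f ⋖ u → v ≤ f := by
    intro u f hu hup hf
    by_contra hvf
    obtain ⟨g, hvg, hg⟩ := exists_le_covBy_of_lt hu
    have hf' : β ∈ side u f := by
      refine (hB.isDownTail_or_mem_side hF hP hf fun h ↦
        hB.low_notMem (hB.side_subset hF hup hf h)).resolve_left fun h ↦ ?_
      obtain ⟨a, ha, ha'⟩ := h.exists_isLowEnd (hIci u hu hup)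
      exact hB.low_notMem (hB.side_subset hF hup hf (hB.isLowEnd.eq hP ha' ▸ ha))
    have hg' : β ∈ side u g := by
      refine (hB.isDownTail_or_mem_side hF hP hg fun h ↦
        hB.low_notMem (hB.side_subset hF hup hg h)).resolve_left fun h ↦ ?_
      rcases mem_side_or_of_adj (Iic_subset_side hg hvg) (Or.inl hc') with h' | ⟨-, h'⟩
      · exact hc'p ((h.2.2 c' h').trans (hg.le.trans hup))
      · exact hc'p (h' ▸ hup)
    exact Set.disjoint_left.1 (disjoint_side_of_ne hF (Or.inr hf) (Or.inr hg)
      fun h ↦ hvf (h ▸ hvg)) hf' hg'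
  have hcD : Set.Iio c = Set.Iic v := by
    ext z
    refine ⟨fun hz ↦ ?_, fun hz ↦ lt_of_le_of_lt hz hc.lt⟩
    obtain ⟨f, hzf, hf⟩ := exists_le_covBy_of_lt (Set.mem_Iio.1 hz)
    have hvf := hlow c f hc.lt hcp hf
    rcases hvf.eq_or_lt with rfl | h
    · exact hzf
    · exact absurd hf.lt (hc.2 h)
  have hvq : v ≤ q := hvp.trans hB.covBy.le
  have hsub : side v c' ⊆ side q p :=
    side_subset_side (Or.inl hc') (Iic_subset_side hB.covBy hvp) fun h ↦
      Set.disjoint_left.1 (disjoint_side_of_ne hF (Or.inl hc) (Or.inl hc') hcc')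
        (Ici_subset_side hc (hcp.trans hB.covBy.le)) h
  rcases hB.isUpTail_or_mem_side hF hP hc' fun h ↦ hB.low_notMem (hsub h) with h | h
  · exact hP.false_up hcc' (hcD.trans h.Iio_eq.symm)
      ((hIci c hc.lt hcp).mono fun _ h ↦ le_of_lt h.1) (h.isChain_Ici.mono fun _ h ↦ le_of_lt h.1)
  · have hIicv : IsChain (· ≤ ·) (Set.Iic v) := isChain_Iic_of_isDownTail hP fun w hw ↦
      (hB.isDownTail_or_mem_side hF hP hw fun h' ↦
        hB.low_notMem (hB.side_subset hF hvp hw h')).resolve_right fun h' ↦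
          Set.disjoint_left.1 (disjoint_side_of_ne hF (Or.inr hw) (Or.inl hc')
            (hw.lt.trans hc'.lt).ne) h' h
    refine hp (isChain_of_total fun x hx y hy ↦ ?_)
    rcases le_or_ge_of_le_covBy hvp hlow hx with h1 | h1 <;>
      rcases le_or_ge_of_le_covBy hvp hlow hy with h2 | h2
    · exact hIicv.total h1 h2
    · exact Or.inl (h1.trans h2)
    · exact Or.inr (h2.trans h1)
    · exact (isChain_Icc hF v p).total ⟨h1, hx⟩ ⟨h2, hy⟩

/-- An upper cover of `p` other than `q` carries no tail: the top of the tail would form a very good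
pair in the dual with the top of the chain above `q`. -/
theorem mem_side_of_covBy (hB : IsLowBranch α e q p β) (hF : (hasse V).IsAcyclic)
    (hP : VeryGoodFree V) {d : V} (hd : p ⋖ d) (hdq : d ≠ q) : β ∈ side p d := by
  refine (hB.isUpTail_or_mem_side hF hP hd fun h ↦
    hB.low_notMem (hB.side_subset_of_covBy hF hd hdq h)).resolve_left fun h ↦ ?_
  obtain ⟨x, hqx, hx⟩ := exists_isMax_ge q
  obtain ⟨b, hdb, hb⟩ := exists_isMax_ge d
  refine hB.not_isChain hP hqx hx (hd.le.trans hdb)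
    (fun h ↦ hdq (eq_of_covBy_of_le hF hd hB.covBy hdb h)) hb (h.2.1.mono fun z hz ↦ ?_)
  by_contra hzs
  exact hz.2 ((covBy_of_le_of_mem_side (Ici_subset_side hd hdb) hzs (le_of_lt hz.1)).2.1.trans_lt
    (hB.covBy.lt.trans_le hqx))

/-! ### Several upper covers at the branching point -/

theorem eq_or_eq_of_covBy (hB : IsLowBranch α e q p β) (hF : (hasse V).IsAcyclic)
    (hP : VeryGoodFree V) {c d : V} (hd : p ⋖ d) (hdq : d ≠ q) (hc : p ⋖ c) : c = q ∨ c = d := by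
  by_contra! h
  exact Set.disjoint_left.1 (disjoint_side_of_ne hF (Or.inl hc) (Or.inl hd) h.2)
    (hB.mem_side_of_covBy hF hP hc h.1) (hB.mem_side_of_covBy hF hP hd hdq)

theorem isDownTail_of_covBy (hB : IsLowBranch α e q p β) (hF : (hasse V).IsAcyclic)
    (hP : VeryGoodFree V) {d w : V} (hd : p ⋖ d) (hdq : d ≠ q) (hw : w ⋖ p) : IsDownTail p w :=
  (hB.isDownTail_or_mem_side hF hP hw fun h ↦
    hB.low_notMem (hB.side_subset hF le_rfl hw h)).resolve_right fun h ↦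
      Set.disjoint_left.1 (disjoint_side_of_ne hF (Or.inr hw) (Or.inl hd)
        (hw.lt.trans hd.lt).ne) h (hB.mem_side_of_covBy hF hP hd hdq)

/-- The least element below `p` would form a very good pair with `α` if the up-set of `d` were
a chain. -/
theorem not_isChain_Ici (hB : IsLowBranch α e q p β) (hF : (hasse V).IsAcyclic)
    (hP : VeryGoodFree V) {d : V} (hd : p ⋖ d) (hdq : d ≠ q) :
    ¬ IsChain (· ≤ ·) (Set.Ici d) := fun hch ↦ by
  have htail : ∀ w, w ⋖ p → IsDownTail p w := fun w hw ↦ hB.isDownTail_of_covBy hF hP hd hdq hw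
  obtain ⟨a, hap, ha⟩ := exists_isMin_le p
  have hne : α ≠ a := fun h ↦ hB.low_notMem (h ▸ Iic_subset_side hB.covBy hap)
  refine hP.false_up hne (hB.isLowEnd.1.Iio_eq.trans ha.Iio_eq.symm)
    (hB.isLowEnd.2.mono fun _ h ↦ le_of_lt h.1) ?_
  have hcomp : ∀ z ∈ Set.Ioi a \ Set.Ioi α, z ≤ p ∨ d ≤ z := by
    intro z hz
    have hzp : z ≤ p ∨ p ≤ z := by
      rcases hap.eq_or_lt with rfl | hlt
      · exact Or.inr (le_of_lt hz.1)
      obtain ⟨w, haw, hw⟩ := exists_le_covBy_of_lt hlt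
      exact (le_of_mem_side_or_ge (Iic_subset_side hw haw) (le_of_lt hz.1)).imp_left
        fun h ↦ ((htail w hw).2.2 z h).trans hw.le
    rcases hzp with h | h
    · exact Or.inl h
    rcases h.eq_or_lt with rfl | h
    · exact Or.inl le_rfl
    obtain ⟨c, hc, hcz⟩ := exists_covBy_le_of_lt h
    rcases hB.eq_or_eq_of_covBy hF hP hd hdq hc with rfl | rfl
    · exact absurd (hB.lt_right.trans_le hcz) hz.2
    · exact Or.inr hcz
  refine isChain_of_total fun x hx y hy ↦ ?_
  rcases hcomp x hx with h1 | h1 <;> rcases hcomp y hy with h2 | h2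
  · exact (isChain_Iic_of_isDownTail hP htail).total h1 h2
  · exact Or.inl (h1.trans (hd.le.trans h2))
  · exact Or.inr (h2.trans (hd.le.trans h1))
  · exact hch.total h1 h2

/-- The case in which some `d` other than `q` covers `p`. Going up from `d`, let `v` be the first
element with several upper covers. One of them carries a tail, and all that hangs off the chain
from `p` to `v` are downward tails. Two such tails have bottoms that form a very good pair; the
top of a single tail hanging at some `u > d` and the lower cover of `u` on the chain form one in
the dual; and if tails hang at most at `d`, then the tops of the chains above `q` and above `v`
form one in the dual. -/
theorem false_of_covBy (hB : IsLowBranch α e q p β) (hF : (hasse V).IsAcyclic)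
    (hP : VeryGoodFree V) {d : V} (hd : p ⋖ d) (hdq : d ≠ q) : False := by
  have hβd := hB.mem_side_of_covBy hF hP hd hdq
  have hαd : α ∉ side p d := fun h ↦ hB.low_notMem (hB.side_subset_of_covBy hF hd hdq h)
  have hpd : p ∉ side p d := notMem_side hF (Or.inl hd)
  have hIicp : IsChain (· ≤ ·) (Set.Iic p) :=
    isChain_Iic_of_isDownTail hP fun w hw ↦ hB.isDownTail_of_covBy hF hP hd hdq hw
  obtain ⟨x, hqx, hx⟩ := exists_isMax_ge q
  have hex : {v | d ≤ v ∧ ∃ c c', v ⋖ c ∧ v ⋖ c' ∧ c ≠ c'}.Nonempty := by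
    by_contra! hcon
    exact hB.not_isChain_Ici hF hP hd hdq (isChain_Ici_of_covBy_unique fun u c c' hu hc hc' ↦
      by_contra fun hne ↦ (hcon.le ⟨hu, c, c', hc, hc', hne⟩ : u ∈ (∅ : Set V)))
  obtain ⟨v, ⟨hdv, f₁, f₂, hf₁, hf₂, hf₁₂⟩, hmin⟩ := (Set.toFinite _).exists_minimal hex
  have hcov : ∀ u c c', d ≤ u → u < v → u ⋖ c → u ⋖ c' → c = c' := fun u c c' hu huv hc hc' ↦
    by_contra fun hne ↦ huv.not_ge (hmin ⟨hu, c, c', hc, hc', hne⟩ huv.le)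
  have hpv : p < v := hd.lt.trans_le hdv
  have hvside : v ∈ side p d := Ici_subset_side hd hdv
  have hαv : ∀ c, v ⋖ c → α ∉ side v c := fun c hc h ↦ hαd <|
    side_subset_side (Or.inl hc) hvside (fun h' ↦
      (covBy_of_le_of_notMem_side h' (notMem_side hF (Or.inl hc)) hpv.le).1.lt.asymm hc.lt) h
  obtain ⟨c₁, c₂, hc₁, hc₂, ht, hβ⟩ :
      ∃ c₁ c₂, v ⋖ c₁ ∧ v ⋖ c₂ ∧ IsUpTail v c₁ ∧ β ∈ side v c₂ := by
    rcases hB.isUpTail_or_mem_side hF hP hf₁ (hαv _ hf₁) with h | h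
    · refine ⟨f₁, f₂, hf₁, hf₂, h, ?_⟩
      exact (hB.isUpTail_or_mem_side hF hP hf₂ (hαv _ hf₂)).resolve_left
        fun h' ↦ hf₁₂ (h.eq hP h')
    · refine ⟨f₂, f₁, hf₂, hf₁, ?_, h⟩
      exact (hB.isUpTail_or_mem_side hF hP hf₂ (hαv _ hf₂)).resolve_right
        fun h' ↦ Set.disjoint_left.1
          (disjoint_side_of_ne hF (Or.inl hf₁) (Or.inl hf₂) hf₁₂) h h'
  have hdu : ∀ u, p < u → u ≤ v → d ≤ u := by
    intro u hu huv
    obtain ⟨c, hc, hcu⟩ := exists_covBy_le_of_lt hu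
    exact eq_of_covBy_of_le hF hc hd (hcu.trans huv) hdv ▸ hcu
  -- The lower covers of elements of `(p, v]` off the chain from `p` to `v` carry tails.
  have htail : ∀ u f, p < u → u ≤ v → f ⋖ u → ¬ p ≤ f → IsDownTail u f := by
    intro u f hu huv hf hpf
    have huf := notMem_side hF (Or.inr hf)
    refine (hB.isDownTail_or_mem_side hF hP hf fun h ↦ hαd ?_).resolve_right fun h ↦ ?_
    · exact side_subset_side (Or.inr hf) (Ici_subset_side hd (hdu u hu huv))
        (fun h' ↦ hpf (covBy_of_le_of_notMem_side h' huf hu.le).2.1) h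
    · refine Set.disjoint_left.1 (disjoint_side (Or.inr hf) (fun h' ↦ ?_) (fun h' ↦ ?_)
        fun h' h'' ↦ ?_) h hβ
      · exact (covBy_of_le_of_mem_side h' huf huv).1.lt.asymm hf.lt
      · exact (covBy_of_le_of_notMem_side h' (notMem_side hF (Or.inl hc₂)) huv).1.lt.asymm hc₂.lt
      · exact (hf.lt.trans (h' ▸ hc₂.lt)).ne h''
  have hup : ∀ u z, p < u → u ≤ v → u ≤ z → z ≤ v ∨ v ≤ z := fun u z hu huv hz ↦
    le_or_ge_of_covBy_le huv (fun w f huw hwv hwf ↦ by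
      obtain ⟨g, hg, hgv⟩ := exists_covBy_le_of_lt hwv
      exact hcov w f g ((hdu u hu huv).trans huw) hwv hwf hg ▸ hgv) hz
  -- There is at most one such tail.
  have huniq : ∀ u f u' f', p < u → u ≤ v → f ⋖ u → ¬ p ≤ f → p < u' → u' ≤ v → f' ⋖ u' →
      ¬ p ≤ f' → u = u' ∧ f = f' := by
    have hnot : ∀ u f u', p < u → u ≤ v → f ⋖ u → ¬ p ≤ f → p < u' → u' ≤ v →
        u' ∉ side u f := by
      intro u f u' hu huv hf hpf hu' huv' h
      have huf := notMem_side hF (Or.inr hf)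
      rcases (isChain_Icc hF p v).total ⟨hu.le, huv⟩ ⟨hu'.le, huv'⟩ with h' | h'
      · exact (covBy_of_le_of_mem_side h huf h').1.lt.asymm hf.lt
      · exact hpf (hu'.le.trans (covBy_of_le_of_notMem_side h huf h').2.1)
    have hchain : ∀ u f u' f' a a', p < u → u ≤ v → f ⋖ u → ¬ p ≤ f → u' ≤ v → f' ⋖ u' →
        a ≤ f → a' ≤ f' → IsChain (· ≤ ·) (Set.Ioi a \ Set.Ioi a') := by
      intro u f u' f' a a' hu huv hf hpf huv' hf' ha ha'
      have ht' := htail u f hu huv hf hpf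
      have hcomp : ∀ z ∈ Set.Ioi a \ Set.Ioi a', z ∈ side u f ∨ z ∈ Set.Icc u v := by
        intro z hz
        refine (le_of_mem_side_or_ge (Iic_subset_side hf ha) (le_of_lt hz.1)).imp_right
          fun h ↦ ⟨h, (hup u z hu huv h).resolve_right fun h' ↦ hz.2 ?_⟩
        exact ha'.trans_lt (hf'.lt.trans_le (huv'.trans h'))
      refine isChain_of_total fun x hx y hy ↦ ?_
      rcases hcomp x hx with h1 | h1 <;> rcases hcomp y hy with h2 | h2
      · exact ht'.2.1.total h1 h2
      · exact Or.inl ((ht'.2.2 x h1).trans (hf.le.trans h2.1))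
      · exact Or.inr ((ht'.2.2 y h2).trans (hf.le.trans h1.1))
      · exact (isChain_Icc hF u v).total h1 h2
    intro u f u' f' hu huv hf hpf hu' huv' hf' hpf'
    by_contra hne
    obtain ⟨a, ha, hmina⟩ := exists_isMin_le f
    obtain ⟨a', ha', hmina'⟩ := exists_isMin_le f'
    have hdis : Disjoint (side u f) (side u' f') := disjoint_side (Or.inr hf)
      (hnot u f u' hu huv hf hpf hu' huv') (hnot u' f' u hu' huv' hf' hpf' hu huv)
      fun h h' ↦ hne ⟨h, h'⟩
    refine hP.false_up (a := a) (b := a') (fun h ↦ Set.disjoint_left.1 hdis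
      (Iic_subset_side hf ha) (h ▸ Iic_subset_side hf' ha'))
      (hmina.Iio_eq.trans hmina'.Iio_eq.symm)
      (hchain u f u' f' a a' hu huv hf hpf huv' hf' ha ha')
      (hchain u' f' u f a' a hu' huv' hf' hpf' huv hf ha' ha)
  by_cases hex' : ∃ u f, d < u ∧ u ≤ v ∧ f ⋖ u ∧ ¬ p ≤ f
  · obtain ⟨u, f, hu, huv, hf, hpf⟩ := hex'
    have hpu := hd.lt.trans hu
    obtain ⟨g, hdg, hg⟩ := exists_le_covBy_of_lt hu
    have ht' := htail u f hpu huv hf hpf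
    have hpg : p ≤ g := hd.le.trans hdg
    have hgU : Set.Ioi g = Set.Ici u := by
      ext z
      refine ⟨fun hz ↦ ?_, fun hz ↦ hg.lt.trans_le hz⟩
      obtain ⟨c, hc, hcz⟩ := exists_covBy_le_of_lt (Set.mem_Ioi.1 hz)
      exact hcov g c u hdg (hg.lt.trans_le huv) hc hg ▸ hcz
    have hgD : IsChain (· ≤ ·) (Set.Iic g) := by
      have hcomp : ∀ z, z ≤ g → z ≤ p ∨ p ≤ z := fun z hz ↦
        le_or_ge_of_le_covBy hpg (fun w k hw hwg hk ↦ by_contra fun hpk ↦ by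
          obtain ⟨rfl, -⟩ := huniq w k u f hw (hwg.trans (hg.le.trans huv)) hk hpk hpu huv hf hpf
          exact hwg.not_gt hg.lt) hz
      refine isChain_of_total fun x hx y hy ↦ ?_
      rcases hcomp x hx with h1 | h1 <;> rcases hcomp y hy with h2 | h2
      · exact hIicp.total h1 h2
      · exact Or.inl (h1.trans h2)
      · exact Or.inr (h2.trans h1)
      · exact (isChain_Icc hF p g).total ⟨h1, hx⟩ ⟨h2, hy⟩
    exact hP.false_down (a := g) (b := f) (fun h ↦ hpf (h ▸ hpg)) (hgU.trans ht'.Ioi_eq.symm)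
      (hgD.mono fun _ h ↦ le_of_lt h.1) (ht'.isChain_Iic.mono fun _ h ↦ le_of_lt h.1)
  · push Not at hex'
    obtain ⟨b, hcb, hb⟩ := exists_isMax_ge c₁
    have hdb : d ≤ b := hdv.trans (hc₁.le.trans hcb)
    refine hB.not_isChain hP hqx hx (hd.le.trans hdb)
      (fun h ↦ hdq (eq_of_covBy_of_le hF hd hB.covBy hdb h)) hb ?_
    have hcomp : ∀ z ∈ Set.Iio b \ Set.Iio x,
        z ∈ side v c₁ ∨ z ∈ Set.Icc d v ∨ ∃ f, IsDownTail d f ∧ z ≤ f := by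
      intro z hz
      by_cases hzs : z ∈ side v c₁
      · exact Or.inl hzs
      refine Or.inr ?_
      have hzp : ¬ z ≤ p := fun h ↦ hz.2 (h.trans_lt (hB.covBy.lt.trans_le hqx))
      have hzv : z ≤ v :=
        (covBy_of_le_of_mem_side (Ici_subset_side hc₁ hcb) hzs (le_of_lt hz.1)).2.1
      have hzd : z ≤ d ∨ d ≤ z := le_or_ge_of_le_covBy hdv (fun u f hu huv hf ↦ by
        have hpf := hex' u f hu huv hf
        rcases hpf.eq_or_lt with rfl | hpf
        · exact absurd hu (hf.2 hd.lt)
        · exact hdu f hpf (hf.le.trans huv)) hzv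
      rcases hzd with h | h
      · rcases h.eq_or_lt with rfl | h
        · exact Or.inl ⟨le_rfl, hzv⟩
        obtain ⟨f, hzf, hf⟩ := exists_le_covBy_of_lt h
        refine Or.inr ⟨f, htail d f hd.lt hdv hf fun hpf ↦ ?_, hzf⟩
        rcases hpf.eq_or_lt with rfl | hpf
        · exact hzp hzf
        · exact hd.2 hpf hf.lt
      · exact Or.inl ⟨h, hzv⟩
    refine isChain_of_total fun x hx y hy ↦ ?_
    rcases hcomp x hx with h1 | h1 | ⟨f, hf, h1⟩ <;>
      rcases hcomp y hy with h2 | h2 | ⟨g, hg, h2⟩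
    · exact ht.2.1.total h1 h2
    · exact Or.inr (h2.2.trans (hc₁.le.trans (ht.2.2 x h1)))
    · exact Or.inr (h2.trans (hg.1.le.trans (hdv.trans (hc₁.le.trans (ht.2.2 x h1)))))
    · exact Or.inl (h1.2.trans (hc₁.le.trans (ht.2.2 y h2)))
    · exact (isChain_Icc hF d v).total h1 h2
    · exact Or.inr (h2.trans (hg.1.le.trans h1.1))
    · exact Or.inl (h1.trans (hf.1.le.trans (hdv.trans (hc₁.le.trans (ht.2.2 y h2)))))
    · exact Or.inl (h1.trans (hf.1.le.trans h2.1))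
    · obtain rfl := hf.eq hP hg
      exact hf.isChain_Iic.total h1 h2

end IsLowBranch

theorem IsLowEnd.false (hF : (hasse V).IsAcyclic) (hP : VeryGoodFree V)
    (hnt : ¬ ∀ x y : V, x ≤ y ∨ y ≤ x) {α : V} (hα : IsLowEnd α) : False := by
  obtain ⟨e, q, p, β, hB⟩ := hα.exists_isLowBranch hF hP hnt
  by_cases h : ∃ d, p ⋖ d ∧ d ≠ q
  · obtain ⟨d, hd, hdq⟩ := h
    exact hB.false_of_covBy hF hP hd hdq
  · push Not at h
    exact hB.false_of_forall_covBy hF hP h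

theorem exists_isVeryGoodPair (hF : (hasse V).IsAcyclic)
    (hnt : ¬ ∀ x y : V, x ≤ y ∨ y ≤ x) : ∃ a b : V, IsVeryGoodPair a b := by
  by_contra! hP
  obtain ⟨r, -⟩ := not_forall.1 hnt
  obtain ⟨e, -, h | h⟩ := exists_isEnd hF hP (s := Set.univ) (fun _ _ _ _ ↦ trivial)
    (Set.mem_univ r)
  · exact h.false hF hP hnt
  · exact (isLowEnd_toDual_iff.2 h).false (hasse_dual_isAcyclic hF) (VeryGoodFree.dual hP)
      fun h' ↦ hnt fun x y ↦ (h' (OrderDual.toDual x) (OrderDual.toDual y)).symm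

end LowEnds

/-! ### Very good pairs yield balanced pairs -/

section Balanced

variable {V : Type*} [PartialOrder V]

theorem linearExtensions_nonempty : (linearExtensions V).Nonempty := by
  obtain ⟨s, hs, hle⟩ := extend_partialOrder ((· ≤ ·) : V → V → Prop)
  exact ⟨s, fun x ↦ refl_of s x, fun _ _ _ ↦ trans_of s, fun _ _ ↦ antisymm_of s,
    fun x y ↦ total_of s x y, hle⟩

/-- The number of linear extensions with a given property. -/
noncomputable def countExt (p : (V → V → Prop) → Prop) : ℕ :=
  {r ∈ linearExtensions V | p r}.ncard

/-- Exchanging `a` with an element `c` that comes before it gives a linear extension again,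
provided that whatever has to precede `a` precedes `c` and whatever has to follow `c` follows
`a`. -/
theorem IsLinearExtension.comp_swap [DecidableEq V] {r : V → V → Prop}
    (hr : IsLinearExtension r) {a c : V} (hca : r c a) (hle : ¬ c ≤ a) (hD : ∀ x, x < a → r x c)
    (hU : ∀ y, c < y → r a y) :
    IsLinearExtension fun x y ↦ r (Equiv.swap a c x) (Equiv.swap a c y) where
  refl x := hr.refl _
  trans x y z := hr.trans _ _ _
  antisymm x y h h' := (Equiv.swap a c).injective (hr.antisymm _ _ h h')
  total x y := hr.total _ _
  extends_le x y hxy := by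
    rcases hxy.eq_or_lt with rfl | hlt
    · exact hr.refl _
    by_cases hxa : x = a
    · subst hxa
      rw [Equiv.swap_apply_left]
      by_cases hyc : y = c
      · rwa [hyc, Equiv.swap_apply_right]
      · rw [Equiv.swap_apply_of_ne_of_ne hlt.ne' hyc]
        exact hr.trans _ _ _ hca (hr.extends_le _ _ hxy)
    by_cases hxc : x = c
    · subst hxc
      have hya : y ≠ a := fun h ↦ hle (h ▸ hxy)
      rw [Equiv.swap_apply_right, Equiv.swap_apply_of_ne_of_ne hya hlt.ne']
      exact hU y hlt
    rw [Equiv.swap_apply_of_ne_of_ne hxa hxc]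
    by_cases hya : y = a
    · subst hya
      rw [Equiv.swap_apply_left]
      exact hD x hlt
    by_cases hyc : y = c
    · subst hyc
      rw [Equiv.swap_apply_right]
      exact hr.trans _ _ _ (hr.extends_le _ _ hxy) hca
    rw [Equiv.swap_apply_of_ne_of_ne hya hyc]
    exact hr.extends_le _ _ hxy

variable [Finite V]

theorem countExt_mono {p p' : (V → V → Prop) → Prop}
    (h : ∀ r, IsLinearExtension r → p r → p' r) : countExt p ≤ countExt p' :=
  Set.ncard_le_ncard (fun r hr ↦ ⟨hr.1, h r hr.1 hr.2⟩) (Set.toFinite _)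

theorem countExt_le_add {p p₁ p₂ : (V → V → Prop) → Prop}
    (h : ∀ r, IsLinearExtension r → p r → p₁ r ∨ p₂ r) :
    countExt p ≤ countExt p₁ + countExt p₂ := by
  refine le_trans (Set.ncard_le_ncard (fun r hr ↦ ?_) (Set.toFinite _)) (Set.ncard_union_le _ _)
  exact (h r hr.1 hr.2).imp (fun h' ↦ ⟨hr.1, h'⟩) fun h' ↦ ⟨hr.1, h'⟩

theorem countExt_true_pos : 0 < countExt fun _ : V → V → Prop ↦ True :=
  (Set.ncard_pos (Set.toFinite _)).2
    (linearExtensions_nonempty.imp fun _ hr ↦ ⟨hr, trivial⟩)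

theorem countExt_add_countExt {x y : V} (h : x ≠ y) :
    countExt (fun r ↦ r x y) + countExt (fun r ↦ r y x) =
      countExt fun _ : V → V → Prop ↦ True := by
  unfold countExt
  rw [← Set.ncard_union_eq (Set.disjoint_left.2 fun r hr hr' ↦
    h (IsLinearExtension.antisymm hr.1 _ _ hr.2 hr'.2)) (Set.toFinite _) (Set.toFinite _)]
  congr 1
  ext r
  constructor
  · rintro (hr | hr) <;> exact ⟨hr.1, trivial⟩
  · intro hr
    exact (IsLinearExtension.total hr.1 x y).imp (fun h ↦ ⟨hr.1, h⟩) fun h ↦ ⟨hr.1, h⟩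

theorem isBalancedPair_of_countExt {x y : V} (hne : x ≠ y)
    (h1 : countExt (fun _ : V → V → Prop ↦ True) ≤ 3 * countExt fun r ↦ r x y)
    (h2 : 3 * countExt (fun r ↦ r x y) ≤ 2 * countExt fun _ : V → V → Prop ↦ True) :
    IsBalancedPair x y := by
  have hpos := countExt_true_pos (V := V)
  have hprob : probBefore x y =
      (countExt fun r ↦ r x y : ℚ) / (countExt fun _ : V → V → Prop ↦ True : ℚ) := by
    simp [probBefore, countExt, hne]
  have hpos' : (0 : ℚ) < (countExt fun _ : V → V → Prop ↦ True : ℚ) := by exact_mod_cast hpos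
  rw [IsBalancedPair, hprob, div_le_div_iff₀ (by norm_num) hpos',
    div_le_div_iff₀ hpos' (by norm_num)]
  constructor
  · rw [mul_comm _ (3 : ℚ), one_mul]
    exact_mod_cast h1
  · rw [mul_comm _ (3 : ℚ)]
    exact_mod_cast h2

/-- Let the elements above `b` but not above `a` form a chain, and let every element below `a` be
below `b`. Of the gaps into which this chain, with `b` added at the bottom, divides a linear
extension, `a` is most often in the lowest: the linear extensions with `a` in the gap right
above `c` are at most as many as those with `a` below `b`. Exchanging `a` and `c` moves `a` from
the gap right above `c` to the one right below. -/
theorem countExt_gap_le {a b : V} (hD : Set.Iio a ⊆ Set.Iio b)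
    (hab : ¬ b ≤ a) (hch : IsChain (· ≤ ·) (Set.Ioi b \ Set.Ioi a)) (c : V)
    (hc : c = b ∨ c ∈ Set.Ioi b \ Set.Ioi a) :
    countExt (fun r ↦ r c a ∧ ∀ d ∈ Set.Ioi b \ Set.Ioi a, c < d → r a d) ≤
      countExt fun r ↦ r a b := by
  classical
  induction c using WellFoundedLT.induction with
  | ind c ih =>
    have hbc : b ≤ c := hc.elim Eq.ge fun h ↦ le_of_lt h.1
    have hca : ¬ c ≤ a := fun h ↦ hab (hbc.trans h)
    have hswap : countExt (fun r ↦ r c a ∧ ∀ d ∈ Set.Ioi b \ Set.Ioi a, c < d → r a d) ≤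
        countExt fun r ↦ r a c ∧ (b < c → r b a) ∧
          ∀ d ∈ Set.Ioi b \ Set.Ioi a, d < c → r d a := by
      refine Set.ncard_le_ncard_of_injOn
        (fun r x y ↦ r (Equiv.swap a c x) (Equiv.swap a c y)) (fun r hr ↦ ?_)
        (fun r _ r' _ h ↦ ?_) (Set.toFinite _)
      · obtain ⟨hr, hrc, hrd⟩ := hr
        have hr : IsLinearExtension r := hr
        have hlt : ∀ d, b ≤ d → d < c → r (Equiv.swap a c d) (Equiv.swap a c a) := by
          intro d hbd hd
          rw [Equiv.swap_apply_left,
            Equiv.swap_apply_of_ne_of_ne (fun h : d = a ↦ hab (h ▸ hbd)) hd.ne]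
          exact hr.extends_le _ _ hd.le
        refine ⟨hr.comp_swap hrc hca (fun x hx ↦ ?_) (fun y hy ↦ ?_), ?_, hlt b le_rfl,
          fun d hd ↦ hlt d (le_of_lt hd.1)⟩
        · exact hr.extends_le _ _ ((le_of_lt (hD hx)).trans hbc)
        · by_cases hay : a < y
          · exact hr.extends_le _ _ hay.le
          · exact hrd y ⟨hbc.trans_lt hy, hay⟩ hy
        · change r (Equiv.swap a c a) (Equiv.swap a c c)
          rwa [Equiv.swap_apply_left, Equiv.swap_apply_right]
      · funext x y
        have := congrFun (congrFun h (Equiv.swap a c x)) (Equiv.swap a c y)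
        simpa using this
    refine hswap.trans ?_
    rcases hc with rfl | hc
    · exact countExt_mono fun r _ h ↦ h.1
    · have hne : {d | (d = b ∨ d ∈ Set.Ioi b \ Set.Ioi a) ∧ d < c}.Nonempty :=
        ⟨b, Or.inl rfl, hc.1⟩
      obtain ⟨c', ⟨hc', hlt⟩, hmax⟩ := (Set.toFinite _).exists_maximal hne
      refine le_trans (countExt_mono fun r hr h ↦ ?_) (ih c' hlt hc')
      refine ⟨hc'.elim (fun h' ↦ h' ▸ h.2.1 hc.1) fun h' ↦ h.2.2 c' h' hlt, fun d hd hcd ↦ ?_⟩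
      rcases hch.total hc hd with h' | h'
      · exact hr.trans _ _ _ h.1 (hr.extends_le _ _ h')
      · rcases h'.eq_or_lt with rfl | h'
        · exact h.1
        · exact absurd hcd (hmax ⟨Or.inr hd, h'⟩ hcd.le).not_gt

/-- The chain above `b` contains a partner for `a` in a balanced pair: along this chain the
number of linear extensions with `a` below `c` grows from at most one half to at least two thirds
of all, and its steps are less than one third unless `a` and `b` themselves are balanced. -/
theorem exists_isBalancedPair_of_two_mul_le {a b : V} (hD : Set.Iio a ⊆ Set.Iio b)
    (hab : ¬ b ≤ a) (hch : IsChain (· ≤ ·) (Set.Ioi b \ Set.Ioi a))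
    (h2 : 2 * countExt (fun r ↦ r a b) ≤ countExt fun _ : V → V → Prop ↦ True) :
    ∃ x y : V, IsBalancedPair x y := by
  have hgap := countExt_gap_le hD hab hch
  by_cases h3 : countExt (fun _ : V → V → Prop ↦ True) ≤ 3 * countExt fun r ↦ r a b
  · exact ⟨a, b, isBalancedPair_of_countExt (fun h ↦ hab h.ge) h3 (by omega)⟩
  push Not at h3
  have hchain : ∀ c d, (c = b ∨ c ∈ Set.Ioi b \ Set.Ioi a) →
      (d = b ∨ d ∈ Set.Ioi b \ Set.Ioi a) → c ≤ d ∨ d ≤ c := by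
    rintro c d (rfl | hc) (rfl | hd)
    · exact Or.inl le_rfl
    · exact Or.inl (le_of_lt hd.1)
    · exact Or.inr (le_of_lt hc.1)
    · exact hch.total hc hd
  have hne' : ∀ c, (c = b ∨ c ∈ Set.Ioi b \ Set.Ioi a) → a ≠ c := fun c hc h ↦
    hab (h ▸ hc.elim Eq.ge fun h' ↦ le_of_lt h'.1)
  obtain ⟨t, ht, htmax⟩ := (Set.toFinite {c | c = b ∨ c ∈ Set.Ioi b \ Set.Ioi a}).exists_maximal
    ⟨b, Or.inl rfl⟩
  have htop : countExt (fun _ : V → V → Prop ↦ True) ≤ 3 * countExt fun r ↦ r a t := by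
    have h4 : countExt (fun r ↦ r t a) ≤ countExt fun r ↦ r a b :=
      le_trans (countExt_mono fun r _ h ↦ ⟨h, fun d hd htd ↦
        absurd htd (htmax (Or.inr hd) htd.le).not_gt⟩) (hgap t ht)
    have h5 := countExt_add_countExt (hne' t ht)
    omega
  have hex : {c | (c = b ∨ c ∈ Set.Ioi b \ Set.Ioi a) ∧
      countExt (fun _ : V → V → Prop ↦ True) ≤ 3 * countExt fun r ↦ r a c}.Nonempty :=
    ⟨t, ht, htop⟩
  obtain ⟨c, ⟨hc, hc3⟩, hcmin⟩ := (Set.toFinite _).exists_minimal hex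
  have hcb : c ≠ b := fun h ↦ by
    subst h
    omega
  have hbc : b < c := (hc.resolve_left hcb).1
  obtain ⟨c', ⟨hc', hlt⟩, hmax⟩ := (Set.toFinite
    {d | (d = b ∨ d ∈ Set.Ioi b \ Set.Ioi a) ∧ d < c}).exists_maximal ⟨b, Or.inl rfl, hbc⟩
  refine ⟨a, c, isBalancedPair_of_countExt (hne' c hc) hc3 ?_⟩
  have h6 : 3 * countExt (fun r ↦ r a c') < countExt fun _ : V → V → Prop ↦ True := by
    by_contra! h
    exact hlt.not_ge (hcmin ⟨hc', h⟩ hlt.le)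
  have h7 : countExt (fun r ↦ r a c) ≤ countExt (fun r ↦ r a c') + countExt fun r ↦ r a b := by
    refine (countExt_le_add fun r hr h ↦ ?_).trans (Nat.add_le_add_left (hgap c' hc') _)
    refine (hr.total a c').imp_right fun h' ↦ ⟨h', fun d hd hcd ↦ ?_⟩
    have hcd' : c ≤ d := (hchain c d hc (Or.inr hd)).elim id fun h'' ↦
      h''.eq_or_lt.elim Eq.ge fun h'' ↦ absurd hcd (hmax ⟨Or.inr hd, h''⟩ hcd.le).not_gt
    exact hr.trans _ _ _ h (hr.extends_le _ _ hcd')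
  omega

theorem IsUpwardVeryGood.exists_isBalancedPair {a b : V} (hne : a ≠ b)
    (h : IsUpwardVeryGood a b) : ∃ x y : V, IsBalancedPair x y := by
  have hnot : ∀ {a b : V}, a ≠ b → Set.Iio a = Set.Iio b → ¬ b ≤ a := fun hne h hle ↦
    lt_irrefl _ (h.le (lt_of_le_of_ne hle hne.symm) : _ < _)
  have hsum := countExt_add_countExt hne
  rcases le_total (countExt fun r ↦ r a b) (countExt fun r ↦ r b a) with hle | hle
  · exact exists_isBalancedPair_of_two_mul_le h.1.le (hnot hne h.1) h.2.2 (by omega)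
  · exact exists_isBalancedPair_of_two_mul_le h.1.ge (hnot hne.symm h.1.symm) h.2.1 (by omega)

end Balanced

theorem probBefore_toDual {V : Type*} [PartialOrder V] (x y : V) :
    probBefore (OrderDual.toDual x) (OrderDual.toDual y) = probBefore y x := by
  let φ : (V → V → Prop) → Vᵒᵈ → Vᵒᵈ → Prop :=
    fun r x y ↦ r (OrderDual.ofDual y) (OrderDual.ofDual x)
  have hφ : Function.Injective φ := fun r r' h ↦ by
    funext x y
    exact congrFun (congrFun h (OrderDual.toDual y)) (OrderDual.toDual x)
  have hlin : ∀ r, IsLinearExtension (φ r) ↔ IsLinearExtension r := fun r ↦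
    ⟨fun h ↦ ⟨h.refl, fun x y z h1 h2 ↦ h.trans z y x h2 h1,
      fun x y h1 h2 ↦ h.antisymm x y h2 h1, fun x y ↦ (h.total x y).symm,
      fun x y hxy ↦ h.extends_le y x hxy⟩,
    fun h ↦ ⟨h.refl, fun x y z h1 h2 ↦ h.trans z y x h2 h1,
      fun x y h1 h2 ↦ h.antisymm x y h2 h1, fun x y ↦ (h.total x y).symm,
      fun x y hxy ↦ h.extends_le y x hxy⟩⟩
  have hall : linearExtensions Vᵒᵈ = φ '' linearExtensions V := by
    ext r
    constructor
    · exact fun hr ↦ ⟨fun x y ↦ r (OrderDual.toDual y) (OrderDual.toDual x), (hlin _).1 hr, rfl⟩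
    · rintro ⟨r, hr, rfl⟩
      exact (hlin r).2 hr
  have hsep : {r ∈ linearExtensions Vᵒᵈ |
      r (OrderDual.toDual x) (OrderDual.toDual y) ∧ OrderDual.toDual x ≠ OrderDual.toDual y} =
      φ '' {r ∈ linearExtensions V | r y x ∧ y ≠ x} := by
    rw [hall]
    ext r
    constructor
    · rintro ⟨⟨r, hr, rfl⟩, h, hne⟩
      exact ⟨r, ⟨hr, h, fun h' ↦ hne h'.symm⟩, rfl⟩
    · rintro ⟨r, ⟨hr, h, hne⟩, rfl⟩
      exact ⟨⟨r, hr, rfl⟩, h, fun h' ↦ hne h'.symm⟩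
  unfold probBefore
  rw [hsep, hall, Set.ncard_image_of_injective _ hφ, Set.ncard_image_of_injective _ hφ]

theorem IsVeryGoodPair.exists_isBalancedPair {V : Type*} [PartialOrder V] [Finite V] {a b : V}
    (h : IsVeryGoodPair a b) : ∃ x y : V, IsBalancedPair x y := by
  obtain ⟨hne, h | h⟩ := h
  · exact h.exists_isBalancedPair hne
  · obtain ⟨x, y, hxy⟩ := IsUpwardVeryGood.exists_isBalancedPair (V := Vᵒᵈ)
      (a := OrderDual.toDual a) (b := OrderDual.toDual b) (fun h' ↦ hne h') h
    refine ⟨OrderDual.ofDual y, OrderDual.ofDual x, ?_⟩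
    rw [IsBalancedPair, ← probBefore_toDual]
    exact hxy

end OrderedSet

theorem theorem3 {V : Type*} [PartialOrder V] [Finite V]
    (hnot_total : ¬ ∀ x y : V, x ≤ y ∨ y ≤ x)
    (hforest : (SimpleGraph.hasse V).IsAcyclic) :
    (∃ a b : V, OrderedSet.IsVeryGoodPair a b) ∧
      (∃ x y : V, OrderedSet.IsBalancedPair x y) := by
  obtain ⟨a, b, h⟩ := OrderedSet.exists_isVeryGoodPair hforest hnot_total
  exact ⟨⟨a, b, h⟩, h.exists_isBalancedPair⟩
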